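/- Let $-\infty\le a<b\le\infty$ and let $w\ge 0$ be a weight on $(a,b)$, not identically zero, such that all moments $\int_a^b x^j w(x)\,dx$ ($j=0,1,2,\dots$) exist, $\sqrt{w}$ is differentiable on $(a,b)$, and $w$ vanishes at the endpoints: $w(x)\to 0$ as $x\to a^+$ and as $x\to b^-$. Let $N\ge 0$ be an integer, let $\pi_j$ be any real polynomial of degree exactly $j$ ($0\le j\le 2N-1$), put $\psi_j=\pi_j\sqrt{w}$, and suppose that each derivative $\psi_j'$ is integrable on $(a,b)$. Let $f:\mathbb{R}\to\mathbb{C}$ be a Schwartz function and let $$ G_N^{(4)}(f)=\frac{\int_{[a,b]^N}\prod_{1\le j<k\le N}(x_j-x_k)^4\prod_{j=1}^N w(x_j)\,[1+f(x_j)]\,dx_j}{\int_{[a,b]^N}\prod_{1\le j<k\le N}(x_j-x_k)^4\prod_{j=1}^N w(x_j)\,dx_j} $$ be the moment generating function of the symplectic ($\beta=4$) ensemble with weight $w$. Then both integrals converge absolutely, the denominator is positive, the matrix $$ M^{(4)}=\left(\int_a^b\big(\psi_j(x)\psi_k'(x)-\psi_j'(x)\psi_k(x)\big)\,dx\right)_{j,k=0}^{2N-1}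 $$ is well defined and invertible, and, writing $(\mu_{jk})_{j,k=0}^{2N-1}=(M^{(4)})^{-1}$, $$ \left[G_N^{(4)}(f)\right]^2=\det\left(I+2K_{N,4}^{(2,2)}f-K_{N,4}^{(2,2)}\varepsilon f'\right), \qquad K_{N,4}^{(2,2)}(x,y)=-\sum_{j,k=0}^{2N-1}\psi_j(x)\,\mu_{jk}\,\psi_k'(y). $$ Here $K_{N,4}^{(2,2)}$ and $\varepsilon$ are the integral operators on $(a,b)$ with kernels $K_{N,4}^{(2,2)}(x,y)$ and $\varepsilon(x,y)=\tfrac12\,\mathrm{sgn}(x-y)$, $f$ and $f'$ act by multiplication (all the composed kernels being given by absolutely convergent integrals), and the determinant of $I+T$, for an integral operator $T$ with kernel $T(x,y)$, is the Fredholm determinant $$ \det(I+T)=\sum_{n=0}^\infty\frac1{n!}\int_{(a,b)^n}\det\big(T(x_i,x_j)\big)_{i,j=1}^n\,dx_1\cdots dx_n, $$ whose integrals and series converge absolutely. -/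

import Mathlib

open MeasureTheory Filter Topology Polynomial
open scoped SchwartzMap

noncomputable section

namespace SymplecticEnsemble

/-- The real points of the interval with (possibly infinite) endpoints `a` and `b`. The endpoints
themselves are left out; they carry no Lebesgue measure. -/
def interval (a b : EReal) : Set ℝ := {x : ℝ | a < (x : EReal) ∧ (x : EReal) < b}

/-- Lebesgue measure on the interval. -/
def intervalMeasure (a b : EReal) : Measure ℝ := volume.restrict (interval a b)

/-- The unnormalized `β = 4` eigenvalue density `∏_{j<k} (x_j - x_k)^4 ∏_j w(x_j)`. -/
def density (w : ℝ → ℝ) (N : ℕ) (x : Fin N → ℝ) : ℝ :=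
  (∏ j : Fin N, ∏ k ∈ Finset.Ioi j, (x j - x k) ^ 4) * ∏ j : Fin N, w (x j)

/-- The reciprocal `1 / C_N^{(4)}` of the normalization constant. -/
def partitionFunction (a b : EReal) (w : ℝ → ℝ) (N : ℕ) : ℝ :=
  ∫ x : Fin N → ℝ, density w N x ∂(Measure.pi fun _ => intervalMeasure a b)

/-- The density multiplied by `∏_j (1 + f(x_j))`. -/
def deformedDensity (w : ℝ → ℝ) (N : ℕ) (f : ℝ → ℂ) (x : Fin N → ℝ) : ℂ :=
  (density w N x : ℂ) * ∏ j : Fin N, (1 + f (x j))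

/-- The moment generating function `G_N^{(4)}(f)`. -/
def momentGen (a b : EReal) (w : ℝ → ℝ) (N : ℕ) (f : ℝ → ℂ) : ℂ :=
  (∫ x : Fin N → ℝ, deformedDensity w N f x ∂(Measure.pi fun _ => intervalMeasure a b)) /
    (partitionFunction a b w N : ℂ)

/-- `ψ = p √w` for a polynomial `p`. -/
def psi (w : ℝ → ℝ) (p : ℝ[X]) (x : ℝ) : ℝ := p.eval x * √(w x)

/-- The integrand `ψ_j ψ_k' - ψ_j' ψ_k` of the entries of `M^{(4)}`. -/
def momentIntegrand (w : ℝ → ℝ) {n : ℕ} (p : Fin n → ℝ[X]) (j k : Fin n) (x : ℝ) : ℝ :=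
  psi w (p j) x * deriv (psi w (p k)) x - deriv (psi w (p j)) x * psi w (p k) x

/-- The matrix `M^{(4)}`. -/
def momentMatrix (a b : EReal) (w : ℝ → ℝ) {n : ℕ} (p : Fin n → ℝ[X]) :
    Matrix (Fin n) (Fin n) ℝ :=
  Matrix.of fun j k => ∫ x, momentIntegrand w p j k x ∂(intervalMeasure a b)

/-- The kernel `K_{N,4}^{(2,2)}(x,y) = -∑_{j,k} ψ_j(x) μ_{jk} ψ_k'(y)` with
`(μ_{jk}) = (M^{(4)})⁻¹`. -/
def kernel22 (a b : EReal) (w : ℝ → ℝ) {n : ℕ} (p : Fin n → ℝ[X]) (x y : ℝ) : ℝ :=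
  -∑ j : Fin n, ∑ k : Fin n,
    psi w (p j) x * (momentMatrix a b w p)⁻¹ j k * deriv (psi w (p k)) y

/-- The kernel `ε(x,y) = sgn(x - y) / 2`. -/
def epsKernel (x y : ℝ) : ℝ := Real.sign (x - y) / 2

/-- The kernel of the composition `AB` of the integral operators on the interval with
kernels `A` and `B`. -/
def compKernel (a b : EReal) (A B : ℝ → ℝ → ℝ) (x y : ℝ) : ℝ :=
  ∫ t, A x t * B t y ∂(intervalMeasure a b)

/-- The kernel of `A g`: multiplication by the function `g`, followed by the integral operator
with kernel `A`. -/
def mulKernel (A : ℝ → ℝ → ℝ) (g : ℝ → ℂ) (x y : ℝ) : ℂ := (A x y : ℂ) * g y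

/-- The kernel of the scalar integral operator `2 K f - K ε f'` with `K = K_{N,4}^{(2,2)}`. -/
def scalarKernel (a b : EReal) (w : ℝ → ℝ) {n : ℕ} (p : Fin n → ℝ[X]) (f : ℝ → ℂ)
    (x y : ℝ) : ℂ :=
  2 * mulKernel (kernel22 a b w p) f x y -
    mulKernel (compKernel a b (kernel22 a b w p) epsKernel) (deriv f) x y

/-- The determinant `det (T(x_i, x_j))_{i,j < n}`. -/
def kernelMinor (T : ℝ → ℝ → ℂ) (n : ℕ) (x : Fin n → ℝ) : ℂ :=
  (Matrix.of fun i j : Fin n => T (x i) (x j)).det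

/-- `d` is the Fredholm determinant `det(I + T)` of the integral operator on the interval with
kernel `T`: all integrals in the Fredholm series
`∑_n (1/n!) ∫ det (T(x_i, x_j))_{i,j < n} dx_1 ⋯ dx_n` exist, and the series converges
absolutely, with sum `d`. -/
def HasFredholmDet (a b : EReal) (T : ℝ → ℝ → ℂ) (d : ℂ) : Prop :=
  (∀ n : ℕ, Integrable (kernelMinor T n) (Measure.pi fun _ => intervalMeasure a b)) ∧
  HasSum (fun n : ℕ => ((n.factorial : ℂ))⁻¹ *
    ∫ x : Fin n → ℝ, kernelMinor T n x ∂(Measure.pi fun _ => intervalMeasure a b)) d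

end SymplecticEnsemble

end

open SymplecticEnsemble

noncomputable section

/-! Write `M` for `momentMatrix` and `P` for `perturbationMatrix`. The density is, up to a constant,
the confluent determinant with columns `ψ_r(x_k)` and `ψ_r'(x_k)` (`exists_det_psi_eq`). Integrating
its Leibniz expansion against `∏ (1 + f(x_k))` gives a Pfaffian (de Bruijn), whose square is a
constant times `det (M + P)` (`exists_integral_deformedDensity_sq_eq`). The constant does not depend
on `f`. The case `f = 0`, where the integral is positive, shows that `M` is invertible, and division
gives `G² = det (1 + M⁻¹ P)`.

On the Fredholm side, `ε` undoes differentiation up to sign because the `ψ_k` vanish at both ends.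
Hence `2 K f - K ε f'` has finite rank, with left factors `ψ_j` and right factors `-∑_k μ_{jk} (2
ψ_k' f + ψ_k f')`. Integrating these against `ψ_l` by parts yields exactly the matrix `M⁻¹ P`
(`integral_pairing`), and the Fredholm determinant of a finite-rank kernel is the determinant of its
pairing matrix (`fredholm_finiteRank`). -/

namespace SymplecticEnsemble

/-! ### Pfaffians as signed sums over permutations. -/

section Pfaffian

open Equiv Matrix

variable {κ : Type*} [Fintype κ] [DecidableEq κ] {R : Type*} [CommRing R]

/-- The signed sum over permutations which equals `2 ^ N * N !` times the Pfaffian of an alternating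
matrix of size `2 N`. -/
def pfaffianSum (A : Matrix (κ ⊕ κ) (κ ⊕ κ) R) : R :=
  ∑ σ : Perm (κ ⊕ κ), ((Perm.sign σ : ℤ) : R) * ∏ k, A (σ (.inl k)) (σ (.inr k))

/-- A non-injective `q` repeats a column of `B` and contributes zero; a bijective `q` permutes the
columns and contributes its sign. -/
theorem sum_prod_mul_det_submatrix (A B : Matrix (κ ⊕ κ) (κ ⊕ κ) R) :
    ∑ q : κ ⊕ κ → κ ⊕ κ, (∏ k, A (q (.inl k)) (q (.inr k))) * (B.submatrix id q).det =
      B.det * pfaffianSum A := by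
  classical
  rw [← Finset.sum_filter_add_sum_filter_not _ (fun q => Function.Bijective q)]
  have hzero : ∑ q : κ ⊕ κ → κ ⊕ κ with ¬ Function.Bijective q,
      (∏ k, A (q (.inl k)) (q (.inr k))) * (B.submatrix id q).det = 0 := by
    refine Finset.sum_eq_zero fun q hq => ?_
    rw [Finset.mem_filter, ← Finite.injective_iff_bijective] at hq
    obtain ⟨i, j, hij, hne⟩ : ∃ i j, q i = q j ∧ i ≠ j := by
      have := hq.2
      rw [Function.Injective] at this
      push Not at this
      exact this
    rw [det_zero_of_column_eq hne (by simp [hij]), mul_zero]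
  rw [hzero, add_zero, pfaffianSum, Finset.mul_sum]
  refine Finset.sum_bij (fun q h => Equiv.ofBijective q (Finset.mem_filter.1 h).2)
    (fun _ _ => Finset.mem_univ _) (fun _ _ _ _ h => by injection h)
    (fun b _ => ⟨b, Finset.mem_filter.2 ⟨Finset.mem_univ _, b.bijective⟩, DFunLike.coe_injective rfl⟩)
    fun q hq => ?_
  have := det_permute' (Equiv.ofBijective q (Finset.mem_filter.1 hq).2) B
  rw [Equiv.coe_ofBijective] at this ⊢
  rw [this]
  ring

/-- Expanding every entry of `B * A * Bᵀ` leaves a sum over all index choices `q`, in which the sum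
over `σ` is the determinant of the columns `q` of `B`. -/
theorem pfaffianSum_congruence (A B : Matrix (κ ⊕ κ) (κ ⊕ κ) R) :
    pfaffianSum (B * A * Bᵀ) = B.det * pfaffianSum A := by
  rw [← sum_prod_mul_det_submatrix]
  have hentry : ∀ r s, (B * A * Bᵀ) r s =
      ∑ c : (κ ⊕ κ) × (κ ⊕ κ), A c.1 c.2 * (B r c.1 * B s c.2) := by
    intro r s
    rw [Fintype.sum_prod_type_right]
    simp only [mul_apply, transpose_apply, Finset.sum_mul]
    exact Finset.sum_congr rfl fun _ _ => Finset.sum_congr rfl fun _ _ => by ring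
  simp only [pfaffianSum, hentry, Finset.prod_univ_sum, Finset.mul_sum, Fintype.piFinset_univ]
  rw [Finset.sum_comm]
  refine Fintype.sum_equiv ((Equiv.arrowProdEquivProdArrow κ (fun _ => κ ⊕ κ)
    (fun _ => κ ⊕ κ)).trans (Equiv.sumArrowEquivProdArrow κ κ (κ ⊕ κ)).symm) _ _ fun q => ?_
  rw [det_apply', Finset.mul_sum]
  refine Finset.sum_congr rfl fun σ _ => ?_
  rw [Finset.prod_mul_distrib, Fintype.prod_sum_type, ← Finset.prod_mul_distrib]
  simp only [Equiv.arrowProdEquivProdArrow, Equiv.sumArrowEquivProdArrow, Equiv.trans_apply,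
    Equiv.coe_fn_mk, Equiv.coe_fn_symm_mk, Sum.elim_inl, Sum.elim_inr, submatrix_apply, id_eq,
    Finset.prod_mul_distrib]
  ring

/-- Transposing one factor amounts to composing `σ` with a transposition, which flips the sign; each
of the factors thus contributes a 2. -/
theorem pfaffianSum_sub_transpose (P : Matrix (κ ⊕ κ) (κ ⊕ κ) R) :
    pfaffianSum (P - Pᵀ) = 2 ^ Fintype.card κ * pfaffianSum P := by
  -- The factors are antisymmetrized one at a time; `S` is the set of those already treated.
  have key : ∀ S : Finset κ, ∑ σ : Perm (κ ⊕ κ), ((Perm.sign σ : ℤ) : R) *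
      ∏ k, (if k ∈ S then P - Pᵀ else P) (σ (.inl k)) (σ (.inr k)) =
      2 ^ S.card * pfaffianSum P := by
    intro S
    induction S using Finset.induction_on with
    | empty => simp [pfaffianSum]
    | insert k S hk ih =>
      have hprod : ∀ (Q : Matrix (κ ⊕ κ) (κ ⊕ κ) R) (σ : Perm (κ ⊕ κ)),
          ∏ l, (if l = k then Q else if l ∈ S then P - Pᵀ else P) (σ (.inl l)) (σ (.inr l)) =
          Q (σ (.inl k)) (σ (.inr k)) * ∏ l ∈ Finset.univ.erase k,
            (if l ∈ S then P - Pᵀ else P) (σ (.inl l)) (σ (.inr l)) := by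
        intro Q σ
        rw [← Finset.mul_prod_erase _ _ (Finset.mem_univ k)]
        congr 1
        · simp
        · exact Finset.prod_congr rfl fun l hl => by rw [if_neg (Finset.ne_of_mem_erase hl)]
      have hins : ∀ σ : Perm (κ ⊕ κ),
          ∏ l, (if l ∈ insert k S then P - Pᵀ else P) (σ (.inl l)) (σ (.inr l)) =
          (∏ l, (if l = k then P else if l ∈ S then P - Pᵀ else P) (σ (.inl l)) (σ (.inr l))) -
          ∏ l, (if l = k then Pᵀ else if l ∈ S then P - Pᵀ else P) (σ (.inl l)) (σ (.inr l)) := by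
        intro σ
        have : ∀ l, (if l ∈ insert k S then P - Pᵀ else P) =
            if l = k then P - Pᵀ else if l ∈ S then P - Pᵀ else P := by
          intro l
          by_cases h : l = k <;> simp [h]
        simp only [this, hprod]
        rw [Matrix.sub_apply, sub_mul]
      have hP : ∀ l, (if l = k then P else if l ∈ S then P - Pᵀ else P) =
          if l ∈ S then P - Pᵀ else P := by
        intro l
        by_cases h : l = k <;> simp [h, hk]
      have hswap : ∑ σ : Perm (κ ⊕ κ), ((Perm.sign σ : ℤ) : R) * ∏ l,
          (if l = k then Pᵀ else if l ∈ S then P - Pᵀ else P) (σ (.inl l)) (σ (.inr l)) =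
          - ∑ σ : Perm (κ ⊕ κ), ((Perm.sign σ : ℤ) : R) * ∏ l,
          (if l = k then P else if l ∈ S then P - Pᵀ else P) (σ (.inl l)) (σ (.inr l)) := by
        rw [← Finset.sum_neg_distrib]
        refine Fintype.sum_equiv (Equiv.mulRight (Equiv.swap (.inl k) (.inr k))) _ _ fun σ => ?_
        rw [hprod, hprod, Equiv.coe_mulRight, Perm.sign_mul, Perm.sign_swap (by simp)]
        have : ∏ l ∈ Finset.univ.erase k, (if l ∈ S then P - Pᵀ else P)
            ((σ * Equiv.swap (Sum.inl k) (Sum.inr k)) (.inl l))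
            ((σ * Equiv.swap (Sum.inl k) (Sum.inr k)) (.inr l)) =
            ∏ l ∈ Finset.univ.erase k, (if l ∈ S then P - Pᵀ else P)
              (σ (.inl l)) (σ (.inr l)) := by
          refine Finset.prod_congr rfl fun l hl => ?_
          have hl := Finset.ne_of_mem_erase hl
          rw [Perm.mul_apply, Perm.mul_apply, Equiv.swap_apply_of_ne_of_ne (by simpa) (by simp),
            Equiv.swap_apply_of_ne_of_ne (by simp) (by simpa)]
        rw [this]
        simp
      simp only [hins, mul_sub, Finset.sum_sub_distrib, hswap]
      simp only [hP, ih, Finset.card_insert_of_notMem hk, pow_succ]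
      ring
  simpa [pfaffianSum] using key Finset.univ

/-- An alternating matrix supported on at most `2 n` indices is a sum of `n` decomposable
alternating matrices. -/
theorem exists_sum_wedge {ι K : Type*} [DecidableEq ι] [Field K] (n : ℕ) :
    ∀ (S : Finset ι) (A : Matrix ι ι K), S.card ≤ 2 * n → (∀ i, A i i = 0) →
    (∀ i j, A i j = -A j i) → (∀ i j, i ∉ S → A i j = 0) →
    ∃ u v : Fin n → ι → K, ∀ i j, A i j = ∑ k, (u k i * v k j - v k i * u k j) := by
  induction n with
  | zero =>
    intro S A hS _ _ hA
    refine ⟨0, 0, fun i j => ?_⟩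
    have : S = ∅ := by simpa using hS
    simp [hA i j (by simp [this])]
  | succ n ih =>
    intro S A hS hdiag hskew hA
    by_cases h0 : ∀ i j, A i j = 0
    · exact ⟨0, 0, fun i j => by simp [h0]⟩
    push Not at h0
    obtain ⟨p, q, hpq⟩ := h0
    have hp : p ∈ S := by
      by_contra h
      exact hpq (hA p q h)
    have hq : q ∈ S := by
      by_contra h
      exact hpq (by rw [hskew, hA q p h, neg_zero])
    have hne : p ≠ q := fun h => hpq (by rw [h, hdiag])
    -- Symplectic elimination: subtracting this wedge clears rows `p` and `q`, so the support loses
    -- two indices.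
    let A' : Matrix ι ι K := fun i j => A i j - (A i q * A p j - A i p * A q j) / A p q
    obtain ⟨u, v, huv⟩ := ih ((S.erase p).erase q) A'
      (by
        rw [Finset.card_erase_of_mem (Finset.mem_erase.2 ⟨hne.symm, hq⟩),
          Finset.card_erase_of_mem hp]
        omega)
      (fun i => by
        simp only [A', hdiag, zero_sub, neg_eq_zero]
        rw [hskew p i, hskew q i]
        ring)
      (fun i j => by
        simp only [A']
        rw [hskew i j, hskew i q, hskew i p, hskew p j, hskew q j]
        ring)
      (fun i j hi => by
        simp only [A']
        by_cases hip : i = p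
        · subst hip
          rw [hdiag]
          field_simp
          ring
        by_cases hiq : i = q
        · subst hiq
          rw [hdiag, hskew i p]
          field_simp
          ring
        have hiS : i ∉ S := fun h => hi (Finset.mem_erase.2 ⟨hiq, Finset.mem_erase.2 ⟨hip, h⟩⟩)
        simp [hA i _ hiS])
    refine ⟨Fin.cons (fun i => A i q / A p q) u, Fin.cons (fun i => A p i) v, fun i j => ?_⟩
    rw [Fin.sum_univ_succ]
    simp only [Fin.cons_zero, Fin.cons_succ, ← huv, A']
    rw [hskew p i, hskew q j]
    ring

/-- Up to a constant factor, the square of the Pfaffian sum is the determinant. -/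
theorem exists_pfaffianSum_sq_eq (K : Type*) [Field K] (n : ℕ) :
    ∃ c : K, ∀ A : Matrix (Fin n ⊕ Fin n) (Fin n ⊕ Fin n) K, (∀ i, A i i = 0) →
      (∀ i j, A i j = -A j i) → pfaffianSum A ^ 2 = c * A.det := by
  let J : Matrix (Fin n ⊕ Fin n) (Fin n ⊕ Fin n) K := fromBlocks 0 1 (-1) 0
  have hJ : IsUnit J.det := by
    rw [← isUnit_iff_isUnit_det]
    refine IsUnit.of_mul_eq_one (fromBlocks 0 (-1) 1 0) ?_
    simp [J, fromBlocks_multiply]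
  -- The constant is read off at the standard symplectic matrix `J`. Every alternating `A` has the
  -- form `B * J * Bᵀ`, with `B` allowed to be singular.
  refine ⟨pfaffianSum J ^ 2 / J.det, fun A hdiag hskew => ?_⟩
  obtain ⟨u, v, huv⟩ := exists_sum_wedge n Finset.univ A (by simp [two_mul]) hdiag hskew (by simp)
  let B : Matrix (Fin n ⊕ Fin n) (Fin n ⊕ Fin n) K := of fun i => Sum.elim (u · i) (v · i)
  have hA : A = B * J * Bᵀ := by
    ext i j
    rw [huv]
    simp [B, J, mul_apply, Fintype.sum_sum_type, one_apply, Finset.sum_sub_distrib]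
    ring
  rw [hA, pfaffianSum_congruence, det_mul, det_mul, det_transpose]
  field_simp [hJ.ne_zero]

end Pfaffian

/-! ### Fredholm determinants of finite-rank kernels. -/

section Fredholm

open Equiv Matrix

variable {ι : Type*} [Fintype ι] [DecidableEq ι]

/-- Multilinearity in the rows: choosing rows of `G` on `s` and rows of the identity elsewhere
leaves a principal minor. -/
theorem det_one_add_eq_sum_minors {R : Type*} [CommRing R] (G : Matrix ι ι R) :
    (1 + G).det = ∑ s : Finset ι, (G.submatrix (Subtype.val : s → ι) (Subtype.val : s → ι)).det := by
  rw [add_comm]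
  have h := (detRowAlternating : (ι → R) [⋀^ι]→ₗ[R] R).map_add_univ G.row (1 : Matrix ι ι R).row
  simp only [← det_piecewise_one_eq_submatrix_det]
  exact h

theorem card_embedding_map_eq (n : ℕ) (s : Finset ι) (hs : s.card = n) :
    (Finset.univ.filter fun φ : Fin n ↪ ι => Finset.univ.map φ = s).card = n.factorial := by
  subst hs
  rw [← Fintype.card_subtype]
  have e : {φ : Fin s.card ↪ ι // Finset.univ.map φ = s} ≃ (Fin s.card ≃ s) :=
    { toFun := fun φ => (Equiv.ofInjective φ.1 φ.1.injective).trans (Equiv.subtypeEquivRight fun i => by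
        rw [show i ∈ s ↔ i ∈ Finset.univ.map φ.1 by rw [φ.2]]
        simp)
      invFun := fun g => ⟨g.toEmbedding.trans (Function.Embedding.subtype _), by
        ext i
        simp only [Finset.mem_map, Finset.mem_univ, true_and]
        constructor
        · rintro ⟨j, rfl⟩
          exact (g j).2
        · intro hi
          exact ⟨g.symm ⟨i, hi⟩, by simp⟩⟩
      left_inv := fun φ => by
        ext i
        simp
      right_inv := fun g => by
        ext i
        simp }
  rw [Fintype.card_congr e, Fintype.card_equiv s.equivFin.symm, Fintype.card_fin]

/-- Non-injective `φ` repeat a row, and each `n`-subset is the image of `n!` injective ones, all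
giving the same principal minor. -/
theorem sum_det_submatrix_eq {R : Type*} [CommRing R] (G : Matrix ι ι R) (n : ℕ) :
    ∑ φ : Fin n → ι, (G.submatrix φ φ).det = n.factorial *
      ∑ s ∈ Finset.univ.powersetCard n, (G.submatrix (Subtype.val : s → ι) (Subtype.val : s → ι)).det := by
  classical
  have h1 : ∑ φ : Fin n → ι, (G.submatrix φ φ).det =
      ∑ φ : Fin n ↪ ι, (G.submatrix φ φ).det := by
    refine (Finset.sum_of_injOn (fun φ : Fin n ↪ ι => (φ : Fin n → ι))
      (DFunLike.coe_injective.injOn) (by simp) ?_ (fun _ _ => rfl)).symm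
    intro φ _ hφ
    have hinj : ¬ Function.Injective φ := fun h => hφ ⟨⟨φ, h⟩, by simp⟩
    rw [Function.Injective] at hinj
    push Not at hinj
    obtain ⟨i, j, hij, hne⟩ := hinj
    exact det_zero_of_row_eq hne (by ext; simp [hij])
  have h2 : ∀ φ : Fin n ↪ ι, φ ∈ (Finset.univ : Finset (Fin n ↪ ι)) →
      Finset.univ.map φ ∈ (Finset.univ : Finset ι).powersetCard n := by
    intro φ _
    simp [Finset.mem_powersetCard]
  rw [h1, ← Finset.sum_fiberwise_of_maps_to h2, Finset.mul_sum]
  refine Finset.sum_congr rfl fun s hs => ?_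
  have hs' := (Finset.mem_powersetCard.1 hs).2
  rw [← card_embedding_map_eq n s hs', ← nsmul_eq_mul, ← Finset.sum_const]
  refine Finset.sum_congr rfl fun φ hφ => ?_
  have hφ := (Finset.mem_filter.1 hφ).2
  have hmem : ∀ i, φ i ∈ s := fun i => by simp [← hφ]
  have hbij : Function.Bijective fun i => (⟨φ i, hmem i⟩ : s) := by
    refine (Fintype.bijective_iff_injective_and_card _).2 ⟨fun i j h => ?_, by simp [hs']⟩
    exact φ.injective (congrArg Subtype.val h)
  rw [← det_submatrix_equiv_self (Equiv.ofBijective _ hbij)]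
  rfl

theorem hasSum_det_one_add (G : Matrix ι ι ℂ) :
    HasSum (fun n : ℕ => ((n.factorial : ℂ))⁻¹ * ∑ φ : Fin n → ι, (G.submatrix φ φ).det)
      (1 + G).det := by
  have hterm : ∀ n : ℕ, ((n.factorial : ℂ))⁻¹ * ∑ φ : Fin n → ι, (G.submatrix φ φ).det =
      ∑ s ∈ Finset.univ.powersetCard n, (G.submatrix (Subtype.val : s → ι) (Subtype.val : s → ι)).det := by
    intro n
    rw [sum_det_submatrix_eq, inv_mul_cancel_left₀ (by exact_mod_cast n.factorial_ne_zero)]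
  simp only [hterm]
  rw [det_one_add_eq_sum_minors, ← Finset.powerset_univ, Finset.sum_powerset]
  refine hasSum_sum_of_ne_finset_zero fun n hn => ?_
  rw [Finset.powersetCard_eq_empty.2 (by simpa [Nat.lt_succ_iff] using hn), Finset.sum_empty]

/-- Reindexing `φ` by `σ` collects the two factors that depend on the same variable `x i`, so that
the integral factorizes. -/
theorem det_finiteRank {ι α : Type*} [Fintype ι] (u v : ι → α → ℂ) (n : ℕ) (x : Fin n → α) :
    (Matrix.of fun i j : Fin n => ∑ l, u l (x i) * v l (x j)).det =
      ∑ φ : Fin n → ι, ∑ σ : Perm (Fin n), ((Perm.sign σ : ℤ) : ℂ) *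
        ∏ i, (v (φ (σ i)) (x i) * u (φ i) (x i)) := by
  classical
  rw [det_apply', Finset.sum_comm]
  refine Finset.sum_congr rfl fun σ _ => ?_
  simp only [of_apply, Finset.prod_univ_sum, Fintype.piFinset_univ]
  rw [← Finset.mul_sum]
  congr 1
  refine (Fintype.sum_equiv (Equiv.arrowCongr σ.symm (Equiv.refl ι)) _ _ fun φ => ?_).symm
  rw [Finset.prod_mul_distrib, Finset.prod_mul_distrib, mul_comm]
  congr 1
  rw [← Equiv.prod_comp σ]
  simp [Equiv.arrowCongr]

/-- The minors of a finite-rank kernel are integrable, and the Fredholm series sums to a finite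
determinant. -/
theorem fredholm_finiteRank {α : Type*} [MeasurableSpace α] {μ : Measure α} [SigmaFinite μ]
    (u v : ι → α → ℂ)
    (hint : ∀ j l, Integrable (fun x => v j x * u l x) μ) :
    (∀ n : ℕ, Integrable (fun x : Fin n → α =>
      (Matrix.of fun i j : Fin n => ∑ l, u l (x i) * v l (x j)).det) (Measure.pi fun _ => μ)) ∧
    HasSum (fun n : ℕ => ((n.factorial : ℂ))⁻¹ * ∫ x : Fin n → α,
      (Matrix.of fun i j : Fin n => ∑ l, u l (x i) * v l (x j)).det ∂(Measure.pi fun _ => μ))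
      (1 + Matrix.of fun j l => ∫ x, v j x * u l x ∂μ).det := by
  have hI : ∀ (n : ℕ) (φ : Fin n → ι) (σ : Perm (Fin n)), Integrable (fun x : Fin n → α =>
      ((Perm.sign σ : ℤ) : ℂ) * ∏ i, (v (φ (σ i)) (x i) * u (φ i) (x i)))
      (Measure.pi fun _ => μ) := fun n φ σ =>
    (Integrable.fintype_prod (f := fun i x => v (φ (σ i)) x * u (φ i) x)
      fun i => hint _ _).const_mul _
  simp only [det_finiteRank]
  refine ⟨fun n => integrable_finsetSum _ fun φ _ => integrable_finsetSum _ fun σ _ => hI n φ σ, ?_⟩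
  convert hasSum_det_one_add (Matrix.of fun j l => ∫ x, v j x * u l x ∂μ) using 3 with n
  rw [integral_finsetSum _ fun φ _ => integrable_finsetSum _ fun σ _ => hI n φ σ]
  refine Finset.sum_congr rfl fun φ _ => ?_
  rw [integral_finsetSum _ fun σ _ => hI n φ σ, det_apply']
  refine Finset.sum_congr rfl fun σ _ => ?_
  rw [integral_const_mul, integral_fintype_prod_eq_prod
    (fun i x => v (φ (σ i)) x * u (φ i) x)]
  rfl

end Fredholm

/-! ### The confluent Vandermonde determinant. -/

section Confluent

open Matrix

theorem det_vandermonde_append {R : Type*} [CommRing R] {n : ℕ} (x y : Fin n → R) :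
    (vandermonde (Fin.append x y)).det =
      (∏ i, ∏ j ∈ Finset.Ioi i, (x j - x i)) * (∏ i, ∏ j ∈ Finset.Ioi i, (y j - y i)) *
        ∏ i, ∏ j, (y j - x i) := by
  have hIoi : ∀ {m : ℕ} (i : Fin m) (g : Fin m → R),
      ∏ j ∈ Finset.Ioi i, g j = ∏ j, if i < j then g j else 1 := by
    intro m i g
    rw [← Finset.prod_filter]
    congr 1
    ext
    simp
  rw [det_vandermonde, Fin.prod_univ_add]
  simp only [hIoi, Fin.prod_univ_add, Fin.append_left, Fin.append_right]
  have h1 : ∀ i j : Fin n, Fin.castAdd n i < Fin.natAdd n j := fun i j => by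
    simp only [Fin.lt_def, Fin.val_castAdd, Fin.val_natAdd]; omega
  have h2 : ∀ i j : Fin n, ¬ Fin.natAdd n i < Fin.castAdd n j := fun i j => (h1 j i).asymm
  have h3 : ∀ i j : Fin n, Fin.castAdd n i < Fin.castAdd n j ↔ i < j := fun i j => by
    simp only [Fin.lt_def, Fin.val_castAdd]
  have h4 : ∀ i j : Fin n, Fin.natAdd n i < Fin.natAdd n j ↔ i < j := fun i j => by
    simp only [Fin.lt_def, Fin.val_natAdd, add_lt_add_iff_left]
  simp only [h1, h2, h3, h4, if_true, if_false, Finset.prod_const_one, one_mul,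
    Finset.prod_mul_distrib]
  ring

/-- The determinant of the coefficients of polynomials of degrees `0, …, n - 1`. -/
theorem det_coeff_ne_zero {n : ℕ} (p : Fin n → ℝ[X])
    (hp : ∀ j, (p j).degree = ((j : ℕ) : WithBot ℕ)) :
    (Matrix.of fun i j : Fin n => (p j).coeff i).det ≠ 0 := by
  rw [det_of_isUpperTriangular]
  · refine Finset.prod_ne_zero_iff.2 fun i _ => ?_
    rw [of_apply]
    exact coeff_ne_zero_of_eq_degree (hp i)
  · intro i j hij
    exact coeff_eq_zero_of_degree_lt (by rw [hp]; exact_mod_cast hij)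

theorem det_eval_sumElim {n : ℕ} (p : Fin (n + n) → ℝ[X])
    (hp : ∀ j, (p j).degree = ((j : ℕ) : WithBot ℕ)) (x y : Fin n → ℝ) :
    (Matrix.of fun r c : Fin n ⊕ Fin n => (p (finSumFinEquiv r)).eval (Sum.elim x y c)).det =
      (Matrix.of fun i j : Fin (n + n) => (p j).coeff i).det *
        ((∏ i, ∏ j ∈ Finset.Ioi i, (x j - x i)) * (∏ i, ∏ j ∈ Finset.Ioi i, (y j - y i)) *
          ∏ i, ∏ j, (y j - x i)) := by
  rw [← det_vandermonde_append, mul_comm, ← det_mul,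
    ← eval_matrixOfPolynomials_eq_vandermonde_mul_matrixOfPolynomials _ _
      (fun i => (natDegree_eq_of_degree_eq_some (hp i)).le), ← det_transpose,
    ← det_submatrix_equiv_self finSumFinEquiv]
  congr 1
  ext (r | r) (c | c) <;> simp [-Fin.natAdd_eq_addNat]

/-- This is right multiplication by a block triangular matrix. It serves both for difference
quotients and for discarding the `(√w)'` term of `ψ'`. -/
theorem det_sumElim_add {n : ℕ} {ρ R : Type*} [CommRing R] (e : Fin n ⊕ Fin n → ρ)
    (F G : ρ → Fin n → R) (s t d : Fin n → R) :
    (Matrix.of fun r c : Fin n ⊕ Fin n => Sum.elim (fun k => F (e r) k * s k)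
      (fun k => F (e r) k * d k + G (e r) k * t k) c).det =
      (Matrix.of fun r c : Fin n ⊕ Fin n => Sum.elim (F (e r)) (G (e r)) c).det *
        ((∏ k, s k) * ∏ k, t k) := by
  have : (∏ k, s k) * ∏ k, t k = (fromBlocks (diagonal s) (diagonal d) 0 (diagonal t)).det := by
    simp
  rw [this, ← det_mul]
  congr 1
  ext r (c | c) <;> simp [mul_apply, Fintype.sum_sum_type, diagonal_apply]

/-- The confluent Vandermonde determinant. -/
theorem exists_det_confluent_eq {n : ℕ} (p : Fin (n + n) → ℝ[X])
    (hp : ∀ j, (p j).degree = ((j : ℕ) : WithBot ℕ)) :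
    ∃ c : ℝ, c ≠ 0 ∧ ∀ x : Fin n → ℝ,
      (Matrix.of fun r c : Fin n ⊕ Fin n => Sum.elim
        (fun k => (p (finSumFinEquiv r)).eval (x k))
        (fun k => (derivative (p (finSumFinEquiv r))).eval (x k)) c).det =
      c * ∏ j : Fin n, ∏ k ∈ Finset.Ioi j, (x j - x k) ^ 4 := by
  set L := (Matrix.of fun i j : Fin (n + n) => (p j).coeff i).det with hL
  -- One sign per pair: the limit produces `(x_j - x_i)² (x_j - x_i) (x_i - x_j)`.
  refine ⟨L * ∏ j : Fin n, ∏ k ∈ Finset.Ioi j, (-1 : ℝ), mul_ne_zero (det_coeff_ne_zero p hp)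
    (Finset.prod_ne_zero_iff.2 fun i _ => Finset.prod_ne_zero_iff.2 fun j _ => by norm_num),
    fun x => ?_⟩
  -- `D` replaces derivatives by difference quotients with step `t`. For `t ≠ 0` it is a Vandermonde
  -- determinant in the points `x` and `x + t`, divided by `t ^ n`; `E` is its continuous extension
  -- to `t = 0`.
  let D : ℝ → ℝ := fun t => (Matrix.of fun r c : Fin n ⊕ Fin n => Sum.elim
        (fun k => (p (finSumFinEquiv r)).eval (x k))
        (fun k => t⁻¹ * ((p (finSumFinEquiv r)).eval (x k + t) -
          (p (finSumFinEquiv r)).eval (x k))) c).det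
  let E : ℝ → ℝ := fun t => L * ((∏ i, ∏ j ∈ Finset.Ioi i, (x j - x i)) ^ 2 *
    ∏ i, ∏ j ∈ {i}ᶜ, (x j - x i + t))
  have hDE : ∀ t : ℝ, t ≠ 0 → D t = E t := by
    intro t ht
    have h1 := det_eval_sumElim p hp x (fun k => x k + t)
    have h2 := det_sumElim_add (fun r : Fin n ⊕ Fin n => finSumFinEquiv r)
      (fun r k => (p r).eval (x k)) (fun r k => t⁻¹ * ((p r).eval (x k + t) - (p r).eval (x k)))
      (fun _ => 1) (fun _ => t) (fun _ => 1)
    have h3 : (Matrix.of fun r c : Fin n ⊕ Fin n => Sum.elim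
        (fun k => (p (finSumFinEquiv r)).eval (x k) * 1)
        (fun k => (p (finSumFinEquiv r)).eval (x k) * 1 + t⁻¹ * ((p (finSumFinEquiv r)).eval
          (x k + t) - (p (finSumFinEquiv r)).eval (x k)) * t) c) =
        Matrix.of fun r c : Fin n ⊕ Fin n => (p (finSumFinEquiv r)).eval
          (Sum.elim x (fun k => x k + t) c) := by
      ext r (c | c)
      · simp
      · simp only [of_apply, Sum.elim_inr]
        field_simp
        ring
    rw [h3, h1] at h2
    -- The `n` diagonal factors `j = i` of the mixed product are each equal to `t`.
    have h4 : ∏ i, ∏ j, (x j + t - x i) = t ^ n * ∏ i, ∏ j ∈ {i}ᶜ, (x j - x i + t) := by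
      have : ∀ i, ∏ j, (x j + t - x i) = t * ∏ j ∈ {i}ᶜ, (x j - x i + t) := by
        intro i
        rw [Fintype.prod_eq_mul_prod_compl i]
        congr 1
        · ring
        · exact Finset.prod_congr rfl fun _ _ => by ring
      simp [this, Finset.prod_mul_distrib]
    rw [h4] at h2
    simp only [Finset.prod_const_one, Finset.prod_const, Finset.card_univ, Fintype.card_fin,
      one_mul, add_sub_add_right_eq_sub] at h2
    have ht' : t ^ n ≠ 0 := pow_ne_zero _ ht
    refine mul_right_cancel₀ ht' ?_
    rw [← h2]
    simp only [E]
    ring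
  have hDlim : Tendsto D (𝓝[≠] 0) (𝓝 (Matrix.of fun r c : Fin n ⊕ Fin n => Sum.elim
        (fun k => (p (finSumFinEquiv r)).eval (x k))
        (fun k => (derivative (p (finSumFinEquiv r))).eval (x k)) c).det) := by
    refine ((continuous_id.matrix_det).tendsto _).comp ?_
    refine tendsto_pi_nhds.2 fun r => tendsto_pi_nhds.2 fun c => ?_
    rcases c with c | c
    · exact tendsto_const_nhds
    · have := ((p (finSumFinEquiv r)).hasDerivAt (x c)).tendsto_slope_zero
      simpa using this
  have hElim : Tendsto E (𝓝[≠] 0) (𝓝 (E 0)) := by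
    have : Continuous E := by fun_prop
    exact this.continuousAt.tendsto.mono_left nhdsWithin_le_nhds
  have heq := tendsto_nhds_unique (hDlim.congr' (by
    filter_upwards [self_mem_nhdsWithin] with t ht using hDE t ht)) hElim
  rw [heq]
  simp only [E, add_zero]
  rw [← Finset.prod_prod_Ioi_mul_eq_prod_prod_off_diag fun j i => x j - x i, mul_assoc,
    ← Finset.prod_pow, ← Finset.prod_mul_distrib, ← Finset.prod_mul_distrib]
  congr 1
  refine Finset.prod_congr rfl fun i _ => ?_
  rw [← Finset.prod_pow, ← Finset.prod_mul_distrib, ← Finset.prod_mul_distrib]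
  exact Finset.prod_congr rfl fun j _ => by ring

end Confluent

/-! ### Calculus on an interval with possibly infinite endpoints. -/

section Interval

variable {a b : EReal}

theorem isOpen_interval (a b : EReal) : IsOpen (interval a b) :=
  isOpen_Ioo.preimage continuous_coe_real_ereal

theorem measurableSet_interval (a b : EReal) : MeasurableSet (interval a b) :=
  (isOpen_interval a b).measurableSet

theorem ae_mem_interval (a b : EReal) : ∀ᵐ x ∂(intervalMeasure a b), x ∈ interval a b :=
  ae_restrict_mem (measurableSet_interval a b)

instance (a b : EReal) : SigmaFinite (intervalMeasure a b) := by
  unfold intervalMeasure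
  infer_instance

/-- The pulled-back filter treats finite and infinite endpoints uniformly; this lemma and the next
three identify it in each case. -/
theorem comap_coe_nhdsGT_coe (a : ℝ) : comap ((↑) : ℝ → EReal) (𝓝[>] (a : EReal)) = 𝓝[>] a := by
  rw [nhdsWithin, comap_inf, comap_principal, ← EReal.isEmbedding_coe.nhds_eq_comap, nhdsWithin]
  congr 2
  ext x
  simp

theorem comap_coe_nhdsLT_coe (a : ℝ) : comap ((↑) : ℝ → EReal) (𝓝[<] (a : EReal)) = 𝓝[<] a := by
  rw [nhdsWithin, comap_inf, comap_principal, ← EReal.isEmbedding_coe.nhds_eq_comap, nhdsWithin]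
  congr 2
  ext x
  simp

theorem comap_coe_nhdsGT_bot : comap ((↑) : ℝ → EReal) (𝓝[>] (⊥ : EReal)) = atBot := by
  rw [show Set.Ioi (⊥ : EReal) = {⊥}ᶜ by ext; simp [bot_lt_iff_ne_bot], EReal.nhdsWithin_bot,
    comap_map EReal.coe_injective]

theorem comap_coe_nhdsLT_top : comap ((↑) : ℝ → EReal) (𝓝[<] (⊤ : EReal)) = atTop := by
  rw [show Set.Iio (⊤ : EReal) = {⊤}ᶜ by ext; simp [lt_top_iff_ne_top], EReal.nhdsWithin_top,
    comap_map EReal.coe_injective]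

variable {E : Type*} [NormedAddCommGroup E] [NormedSpace ℝ E]

theorem integral_inter_Iic_of_hasDerivAt [CompleteSpace E] {g g' : ℝ → E}
    (hderiv : ∀ x ∈ interval a b, HasDerivAt g (g' x) x)
    (hint : Integrable g' (intervalMeasure a b))
    (hlim : Tendsto g (comap ((↑) : ℝ → EReal) (𝓝[>] a)) (𝓝 0)) {y : ℝ} (hy : y ∈ interval a b) :
    ∫ x in interval a b ∩ Set.Iic y, g' x = g y := by
  have hsub : IntegrableOn g' (interval a b ∩ Set.Iic y) :=
    IntegrableOn.mono_set hint Set.inter_subset_left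
  induction a with
  | bot =>
    have hset : interval ⊥ b ∩ Set.Iic y = Set.Iic y := by
      refine Set.inter_eq_right.2 fun x hx => ⟨EReal.bot_lt_coe x, ?_⟩
      exact (EReal.coe_le_coe_iff.2 hx).trans_lt hy.2
    rw [hset] at hsub ⊢
    rw [comap_coe_nhdsGT_bot] at hlim
    rw [integral_Iic_of_hasDerivAt_of_tendsto' (fun x hx => hderiv x (by
      rw [← hset] at hx; exact hx.1)) hsub hlim, sub_zero]
  | top => exact absurd hy.1 (by simp)
  | coe a =>
    have hay : a < y := EReal.coe_lt_coe_iff.1 hy.1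
    have hset : interval a b ∩ Set.Iic y = Set.Ioc a y := by
      ext x
      constructor
      · rintro ⟨h1, h2⟩
        exact ⟨EReal.coe_lt_coe_iff.1 h1.1, h2⟩
      · rintro ⟨h1, h2⟩
        exact ⟨⟨EReal.coe_lt_coe_iff.2 h1, (EReal.coe_le_coe_iff.2 h2).trans_lt hy.2⟩, h2⟩
    rw [hset] at hsub ⊢
    rw [comap_coe_nhdsGT_coe] at hlim
    rw [← intervalIntegral.integral_of_le hay.le,
      intervalIntegral.integral_eq_sub_of_hasDerivAt_of_tendsto hay (fun x hx => hderiv x ?_)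
        ((intervalIntegrable_iff_integrableOn_Ioc_of_le hay.le).2 hsub) hlim
        ((hderiv y hy).continuousAt.tendsto.mono_left nhdsWithin_le_nhds), sub_zero]
    have : x ∈ Set.Ioc a y := ⟨hx.1, hx.2.le⟩
    rw [← hset] at this
    exact this.1

theorem integral_inter_Ioi_of_hasDerivAt [CompleteSpace E] {g g' : ℝ → E}
    (hderiv : ∀ x ∈ interval a b, HasDerivAt g (g' x) x)
    (hint : Integrable g' (intervalMeasure a b))
    (hlim : Tendsto g (comap ((↑) : ℝ → EReal) (𝓝[<] b)) (𝓝 0)) {y : ℝ} (hy : y ∈ interval a b) :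
    ∫ x in interval a b ∩ Set.Ioi y, g' x = -g y := by
  have hsub : IntegrableOn g' (interval a b ∩ Set.Ioi y) :=
    IntegrableOn.mono_set hint Set.inter_subset_left
  induction b with
  | bot => exact absurd hy.2 (by simp)
  | top =>
    have hset : interval a ⊤ ∩ Set.Ioi y = Set.Ioi y := by
      refine Set.inter_eq_right.2 fun x hx => ⟨?_, EReal.coe_lt_top x⟩
      exact hy.1.trans (EReal.coe_lt_coe_iff.2 hx)
    rw [hset] at hsub ⊢
    rw [comap_coe_nhdsLT_top] at hlim
    rw [integral_Ioi_of_hasDerivAt_of_tendsto (hderiv y hy).continuousAt.continuousWithinAt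
      (fun x hx => hderiv x (by rw [← hset] at hx; exact hx.1)) hsub hlim, zero_sub]
  | coe b =>
    have hyb : y < b := EReal.coe_lt_coe_iff.1 hy.2
    have hset : interval a b ∩ Set.Ioi y = Set.Ioo y b := by
      ext x
      constructor
      · rintro ⟨h1, h2⟩
        exact ⟨h2, EReal.coe_lt_coe_iff.1 h1.2⟩
      · rintro ⟨h1, h2⟩
        exact ⟨⟨hy.1.trans (EReal.coe_lt_coe_iff.2 h1), EReal.coe_lt_coe_iff.2 h2⟩, h1⟩
    rw [hset] at hsub ⊢
    rw [comap_coe_nhdsLT_coe] at hlim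
    rw [← integral_Ioc_eq_integral_Ioo, ← intervalIntegral.integral_of_le hyb.le,
      intervalIntegral.integral_eq_sub_of_hasDerivAt_of_tendsto hyb (fun x hx => hderiv x ?_)
        ((intervalIntegrable_iff_integrableOn_Ioo_of_le hyb.le).2 hsub)
        ((hderiv y hy).continuousAt.tendsto.mono_left nhdsWithin_le_nhds) hlim, zero_sub]
    rw [← hset] at hx
    exact hx.1

theorem integral_interval_eq_zero_of_hasDerivAt [CompleteSpace E] {g g' : ℝ → E}
    (hderiv : ∀ x ∈ interval a b, HasDerivAt g (g' x) x)
    (hint : Integrable g' (intervalMeasure a b))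
    (hleft : Tendsto g (comap ((↑) : ℝ → EReal) (𝓝[>] a)) (𝓝 0))
    (hright : Tendsto g (comap ((↑) : ℝ → EReal) (𝓝[<] b)) (𝓝 0)) :
    ∫ x, g' x ∂(intervalMeasure a b) = 0 := by
  rcases (interval a b).eq_empty_or_nonempty with he | ⟨y, hy⟩
  · simp [intervalMeasure, he]
  · rw [intervalMeasure, ← integral_inter_add_sdiff (s := interval a b)
      (measurableSet_Iic (a := y)) hint,
      integral_inter_Iic_of_hasDerivAt hderiv hint hleft hy, Set.sdiff_eq, Set.compl_Iic,
      integral_inter_Ioi_of_hasDerivAt hderiv hint hright hy, add_neg_cancel]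

/-- Differentiable functions on the interval which vanish at both ends and whose derivative is
integrable. -/
structure VanishesAtEnds (a b : EReal) (g : ℝ → ℝ) : Prop where
  hasDerivAt : ∀ x ∈ interval a b, HasDerivAt g (deriv g x) x
  integrable_deriv : Integrable (deriv g) (intervalMeasure a b)
  left : Tendsto g (comap ((↑) : ℝ → EReal) (𝓝[>] a)) (𝓝 0)
  right : Tendsto g (comap ((↑) : ℝ → EReal) (𝓝[<] b)) (𝓝 0)

namespace VanishesAtEnds

variable {g h : ℝ → ℝ}

theorem continuousOn (hg : VanishesAtEnds a b g) : ContinuousOn g (interval a b) :=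
  fun x hx => (hg.hasDerivAt x hx).continuousAt.continuousWithinAt

theorem aestronglyMeasurable (hg : VanishesAtEnds a b g) :
    AEStronglyMeasurable g (intervalMeasure a b) :=
  hg.continuousOn.aestronglyMeasurable (measurableSet_interval a b)

/-- `g` is the integral of its derivative from the left end. This bound makes all products used
below integrable. -/
theorem norm_le (hg : VanishesAtEnds a b g) {x : ℝ} (hx : x ∈ interval a b) :
    ‖g x‖ ≤ ∫ t, ‖deriv g t‖ ∂(intervalMeasure a b) := by
  rw [← integral_inter_Iic_of_hasDerivAt hg.hasDerivAt hg.integrable_deriv hg.left hx]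
  refine (norm_integral_le_integral_norm _).trans ?_
  exact setIntegral_mono_set hg.integrable_deriv.norm (ae_of_all _ fun _ => norm_nonneg _)
    Set.inter_subset_left.eventuallyLE

theorem integrable_mul {φ : ℝ → ℂ} (hg : VanishesAtEnds a b g)
    (hφ : Integrable φ (intervalMeasure a b)) :
    Integrable (fun x => (g x : ℂ) * φ x) (intervalMeasure a b) := by
  refine hφ.bdd_mul (c := ∫ t, ‖deriv g t‖ ∂(intervalMeasure a b))
    (Complex.continuous_ofReal.comp_aestronglyMeasurable hg.aestronglyMeasurable) ?_
  filter_upwards [ae_mem_interval a b] with x hx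
  rw [Complex.norm_real]
  exact hg.norm_le hx

theorem integrable_mul_deriv (hg : VanishesAtEnds a b g) (hh : VanishesAtEnds a b h) :
    Integrable (fun x => g x * deriv h x) (intervalMeasure a b) := by
  refine hh.integrable_deriv.bdd_mul (c := ∫ t, ‖deriv g t‖ ∂(intervalMeasure a b))
    hg.aestronglyMeasurable ?_
  filter_upwards [ae_mem_interval a b] with x hx using hg.norm_le hx

/-- The integrals of `g'` to the right and to the left of `y` are `-g y` and `g y`; half their
difference is `-g y`. -/
theorem integral_deriv_mul_epsKernel (hg : VanishesAtEnds a b g) {y : ℝ} (hy : y ∈ interval a b) :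
    ∫ t, deriv g t * epsKernel t y ∂(intervalMeasure a b) = -g y := by
  have hae : (fun t => deriv g t * epsKernel t y) =ᵐ[intervalMeasure a b] fun t =>
      (1 / 2) * (Set.Ioi y).indicator (deriv g) t - (1 / 2) * (Set.Iic y).indicator (deriv g) t := by
    have : ∀ᵐ t ∂(intervalMeasure a b), t ≠ y := by
      have h0 : ∀ᵐ t ∂(volume : Measure ℝ), t ≠ y := by simp [ae_iff]
      exact ae_restrict_of_ae h0
    filter_upwards [this] with t ht
    rcases lt_or_gt_of_ne ht with h | h
    · simp [epsKernel, Real.sign_of_neg (sub_neg.2 h), h.le]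
      ring
    · simp [epsKernel, Real.sign_of_pos (sub_pos.2 h), h]
      ring
  rw [integral_congr_ae hae, integral_sub
    ((hg.integrable_deriv.indicator measurableSet_Ioi).const_mul _)
    ((hg.integrable_deriv.indicator measurableSet_Iic).const_mul _), integral_const_mul,
    integral_const_mul, integral_indicator measurableSet_Ioi, integral_indicator measurableSet_Iic,
    intervalMeasure, Measure.restrict_restrict measurableSet_Ioi,
    Measure.restrict_restrict measurableSet_Iic, Set.inter_comm, Set.inter_comm (Set.Iic y),
    integral_inter_Iic_of_hasDerivAt hg.hasDerivAt hg.integrable_deriv hg.left hy,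
    integral_inter_Ioi_of_hasDerivAt hg.hasDerivAt hg.integrable_deriv hg.right hy]
  ring

theorem integrable_deriv_mul_epsKernel (hg : VanishesAtEnds a b g) (y : ℝ) :
    Integrable (fun t => deriv g t * epsKernel t y) (intervalMeasure a b) := by
  refine hg.integrable_deriv.mul_bdd (c := 1 / 2) ?_ (ae_of_all _ fun t => ?_)
  · refine Measurable.aestronglyMeasurable ?_
    unfold epsKernel Real.sign
    refine Measurable.div_const (Measurable.ite ?_ measurable_const
      (Measurable.ite ?_ measurable_const measurable_const)) _
    · exact measurableSet_lt (by fun_prop) measurable_const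
    · exact measurableSet_lt measurable_const (by fun_prop)
  · unfold epsKernel
    rcases Real.sign_apply_eq (t - y) with h | h | h <;> rw [h] <;> norm_num

end VanishesAtEnds

end Interval

/-! ### Integrability and boundary behaviour of `ψ = q √w`. -/

section Psi

variable {a b : EReal} {w : ℝ → ℝ}

theorem integrable_eval_mul
    (hw_moments : ∀ j : ℕ, Integrable (fun x => x ^ j * w x) (intervalMeasure a b)) (q : ℝ[X]) :
    Integrable (fun x => q.eval x * w x) (intervalMeasure a b) := by
  simp only [eval_eq_sum_range, Finset.sum_mul, mul_assoc]
  exact integrable_finsetSum _ fun j _ => (hw_moments j).const_mul _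

theorem hasDerivAt_psi (hw_diff : DifferentiableOn ℝ (fun x => √(w x)) (interval a b)) (q : ℝ[X])
    {x : ℝ} (hx : x ∈ interval a b) :
    HasDerivAt (psi w q) (q.eval x * deriv (fun x => √(w x)) x +
      (derivative q).eval x * √(w x)) x := by
  have h := ((hw_diff x hx).differentiableAt ((isOpen_interval a b).mem_nhds hx)).hasDerivAt
  rw [add_comm]
  exact (q.hasDerivAt x).mul h

/-- By the AM-GM inequality, `2 |ψ| ≤ ψ² (1 + x²) + (1 + x²)⁻¹`, and `ψ² (1 + x²)` is a polynomial
times `w`. -/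
theorem integrable_psi (hw_nonneg : ∀ x ∈ interval a b, 0 ≤ w x)
    (hw_moments : ∀ j : ℕ, Integrable (fun x => x ^ j * w x) (intervalMeasure a b))
    (hw_diff : DifferentiableOn ℝ (fun x => √(w x)) (interval a b)) (q : ℝ[X]) :
    Integrable (psi w q) (intervalMeasure a b) := by
  have hbound : Integrable (fun x => (q ^ 2 * (1 + X ^ 2)).eval x * w x + (1 + x ^ 2)⁻¹)
      (intervalMeasure a b) :=
    (integrable_eval_mul hw_moments _).add integrable_inv_one_add_sq.restrict
  refine hbound.mono' ?_ ?_
  · exact (q.continuous.continuousOn.mul hw_diff.continuousOn).aestronglyMeasurable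
      (measurableSet_interval a b)
  · filter_upwards [ae_mem_interval a b] with x hx
    have h1 : (0 : ℝ) < 1 + x ^ 2 := by positivity
    rw [psi, Real.norm_eq_abs]
    simp only [eval_mul, eval_pow, eval_add, eval_one, eval_X]
    set A := eval x q * √(w x) with hA
    have h2 : eval x q ^ 2 * (1 + x ^ 2) * w x = A ^ 2 * (1 + x ^ 2) := by
      rw [hA, mul_pow, Real.sq_sqrt (hw_nonneg x hx)]
      ring
    rw [h2]
    have h4 : 0 < (1 + x ^ 2)⁻¹ := inv_pos.2 h1
    have h5 : 0 ≤ (1 + x ^ 2) * (|A| - (1 + x ^ 2)⁻¹) ^ 2 := by positivity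
    have h6 : (1 + x ^ 2) * (|A| - (1 + x ^ 2)⁻¹) ^ 2 =
        A ^ 2 * (1 + x ^ 2) - 2 * |A| + (1 + x ^ 2)⁻¹ := by
      rw [sub_sq, sq_abs]
      field_simp
    have := abs_nonneg A
    linarith

/-- At a finite endpoint `w → 0` suffices. At an infinite one the polynomial may outgrow the decay
that `w → 0` gives, and integrability of both `ψ` and `ψ'` is used instead. -/
theorem vanishesAtEnds_psi (hw_nonneg : ∀ x ∈ interval a b, 0 ≤ w x)
    (hne : (interval a b).Nonempty)
    (hw_moments : ∀ j : ℕ, Integrable (fun x => x ^ j * w x) (intervalMeasure a b))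
    (hw_diff : DifferentiableOn ℝ (fun x => √(w x)) (interval a b))
    (hw_left : Tendsto w (comap ((↑) : ℝ → EReal) (𝓝[>] a)) (𝓝 0))
    (hw_right : Tendsto w (comap ((↑) : ℝ → EReal) (𝓝[<] b)) (𝓝 0))
    (q : ℝ[X]) (hq : Integrable (deriv (psi w q)) (intervalMeasure a b)) :
    VanishesAtEnds a b (psi w q) := by
  have hderiv : ∀ x ∈ interval a b, HasDerivAt (psi w q) (deriv (psi w q) x) x := fun x hx =>
    (hasDerivAt_psi hw_diff q hx).differentiableAt.hasDerivAt
  have hint := integrable_psi hw_nonneg hw_moments hw_diff q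
  have hsqrt : Tendsto (fun t : ℝ => √t) (𝓝 0) (𝓝 0) := by
    simpa using Real.continuous_sqrt.tendsto 0
  obtain ⟨y, hy⟩ := hne
  refine ⟨hderiv, hq, ?_, ?_⟩
  · induction a with
    | bot =>
      rw [comap_coe_nhdsGT_bot]
      have hsub : Set.Iic y ⊆ interval ⊥ b := fun x hx =>
        ⟨EReal.bot_lt_coe x, (EReal.coe_le_coe_iff.2 hx).trans_lt hy.2⟩
      exact tendsto_zero_of_hasDerivAt_of_integrableOn_Iic (a := y)
        (fun x hx => hderiv x (hsub hx)) (IntegrableOn.mono_set hq hsub)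
        (IntegrableOn.mono_set hint hsub)
    | top => exact absurd hy.1 (by simp)
    | coe a =>
      rw [comap_coe_nhdsGT_coe] at hw_left ⊢
      have := ((q.continuous.tendsto a).mono_left nhdsWithin_le_nhds).mul (hsqrt.comp hw_left)
      rwa [mul_zero] at this
  · induction b with
    | bot => exact absurd hy.2 (by simp)
    | top =>
      rw [comap_coe_nhdsLT_top]
      have hsub : Set.Ioi y ⊆ interval a ⊤ := fun x hx =>
        ⟨hy.1.trans (EReal.coe_lt_coe_iff.2 hx), EReal.coe_lt_top x⟩
      exact tendsto_zero_of_hasDerivAt_of_integrableOn_Ioi (a := y)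
        (fun x hx => hderiv x (hsub hx)) (IntegrableOn.mono_set hq hsub)
        (IntegrableOn.mono_set hint hsub)
    | coe b =>
      rw [comap_coe_nhdsLT_coe] at hw_right ⊢
      have := ((q.continuous.tendsto b).mono_left nhdsWithin_le_nhds).mul (hsqrt.comp hw_right)
      rwa [mul_zero] at this

end Psi

/-! ### De Bruijn's integration formula. -/

section DeBruijn

open Matrix Equiv BoundedContinuousFunction

variable {a b : EReal} {w : ℝ → ℝ} {N : ℕ}

theorem pi_intervalMeasure (a b : EReal) (N : ℕ) :
    (Measure.pi fun _ : Fin N => intervalMeasure a b) =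
      (volume : Measure (Fin N → ℝ)).restrict (Set.univ.pi fun _ => interval a b) := by
  rw [volume_pi, Measure.restrict_pi_pi]
  rfl

theorem ae_pi_mem_interval (a b : EReal) (N : ℕ) :
    ∀ᵐ x ∂(Measure.pi fun _ : Fin N => intervalMeasure a b), ∀ k, x k ∈ interval a b := by
  rw [pi_intervalMeasure]
  filter_upwards [ae_restrict_mem (MeasurableSet.univ_pi fun _ => measurableSet_interval a b)]
    with x hx k using hx k (Set.mem_univ k)

/-- The first `N` indices followed by the last `N` indices. -/
def splitEquiv (N : ℕ) : Fin N ⊕ Fin N ≃ Fin (2 * N) :=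
  finSumFinEquiv.trans (finCongr (two_mul N).symm)

/-- By the product rule, the `(√w)'` part of each derivative column is a combination of the value
columns. What remains is the confluent determinant times `√w(x_k)²` for each `k`. -/
theorem exists_det_psi_eq (hw_nonneg : ∀ x ∈ interval a b, 0 ≤ w x)
    (hw_diff : DifferentiableOn ℝ (fun x => √(w x)) (interval a b)) (p : Fin (2 * N) → ℝ[X])
    (hp : ∀ j, (p j).degree = ((j : ℕ) : WithBot ℕ)) :
    ∃ c : ℝ, c ≠ 0 ∧ ∀ x : Fin N → ℝ, (∀ k, x k ∈ interval a b) →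
      (Matrix.of fun r c : Fin N ⊕ Fin N => Sum.elim
        (fun k => psi w (p (splitEquiv N r)) (x k))
        (fun k => deriv (psi w (p (splitEquiv N r))) (x k)) c).det = c * density w N x := by
  obtain ⟨c, hc, hdet⟩ := exists_det_confluent_eq (fun i => p (finCongr (two_mul N).symm i))
    (fun j => by rw [hp]; simp)
  refine ⟨c, hc, fun x hx => ?_⟩
  have h := det_sumElim_add (splitEquiv N) (fun r k => (p r).eval (x k))
    (fun r k => (derivative (p r)).eval (x k)) (fun k => √(w (x k))) (fun k => √(w (x k)))
    (fun k => deriv (fun x => √(w x)) (x k))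
  have hl : (Matrix.of fun r c : Fin N ⊕ Fin N => Sum.elim
        (fun k => psi w (p (splitEquiv N r)) (x k))
        (fun k => deriv (psi w (p (splitEquiv N r))) (x k)) c) =
      Matrix.of fun r c : Fin N ⊕ Fin N => Sum.elim
        (fun k => (p (splitEquiv N r)).eval (x k) * √(w (x k)))
        (fun k => (p (splitEquiv N r)).eval (x k) * deriv (fun x => √(w x)) (x k) +
          (derivative (p (splitEquiv N r))).eval (x k) * √(w (x k))) c := by
    ext r (k | k)
    · rfl
    · exact (hasDerivAt_psi hw_diff _ (hx k)).deriv
  have hw : ∏ k, √(w (x k)) * √(w (x k)) = ∏ k, w (x k) :=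
    Finset.prod_congr rfl fun k _ => Real.mul_self_sqrt (hw_nonneg _ (hx k))
  rw [hl, h, density, ← mul_assoc c, ← hdet x, ← Finset.prod_mul_distrib, hw]
  rfl

theorem integrable_mul_deriv_mul {g h : ℝ → ℝ} (hg : VanishesAtEnds a b g)
    (hh : VanishesAtEnds a b h) (f : ℝ →ᵇ ℂ) :
    Integrable (fun x => ((g x * deriv h x : ℝ) : ℂ) * f x) (intervalMeasure a b) :=
  (hg.integrable_mul_deriv hh).ofReal.mul_bdd (c := ‖f‖) f.continuous.aestronglyMeasurable
    (ae_of_all _ f.norm_coe_le_norm)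

/-- De Bruijn's formula: the deformed partition function as a Pfaffian. -/
theorem exists_integral_deformedDensity_eq (hw_nonneg : ∀ x ∈ interval a b, 0 ≤ w x)
    (hw_diff : DifferentiableOn ℝ (fun x => √(w x)) (interval a b)) (p : Fin (2 * N) → ℝ[X])
    (hp : ∀ j, (p j).degree = ((j : ℕ) : WithBot ℕ))
    (hψ : ∀ j, VanishesAtEnds a b (psi w (p j))) :
    ∃ c : ℂ, c ≠ 0 ∧ ∀ f : ℝ →ᵇ ℂ,
      Integrable (deformedDensity w N f) (Measure.pi fun _ => intervalMeasure a b) ∧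
      c * ∫ x, deformedDensity w N f x ∂(Measure.pi fun _ => intervalMeasure a b) =
        pfaffianSum (Matrix.of fun r s : Fin N ⊕ Fin N =>
          ∫ x, ((psi w (p (splitEquiv N r)) x * deriv (psi w (p (splitEquiv N s))) x : ℝ) : ℂ) *
            (1 + f x) ∂(intervalMeasure a b)) := by
  obtain ⟨c, hc, hdet⟩ := exists_det_psi_eq hw_nonneg hw_diff p hp
  have hc' : (c : ℂ) ≠ 0 := by exact_mod_cast hc
  refine ⟨c, hc', fun f => ?_⟩
  let F : Fin N ⊕ Fin N → Fin N ⊕ Fin N → ℝ → ℂ := fun r s x =>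
    ((psi w (p (splitEquiv N r)) x * deriv (psi w (p (splitEquiv N s))) x : ℝ) : ℂ) * (1 + f x)
  have hF : ∀ r s, Integrable (F r s) (intervalMeasure a b) := fun r s =>
    integrable_mul_deriv_mul (hψ _) (hψ _) (1 + f)
  have hI : ∀ σ : Perm (Fin N ⊕ Fin N), Integrable (fun x : Fin N → ℝ =>
      ((Perm.sign σ : ℤ) : ℂ) * ∏ k, F (σ (.inl k)) (σ (.inr k)) (x k))
      (Measure.pi fun _ => intervalMeasure a b) := fun σ =>
    (Integrable.fintype_prod (f := fun k => F (σ (.inl k)) (σ (.inr k))) fun _ => hF _ _).const_mul _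
  -- The Leibniz expansion pairs the two columns belonging to `x k`, so each term is a product of
  -- functions of one variable. This gives integrability as well as the value.
  have hae : (fun x => ∑ σ : Perm (Fin N ⊕ Fin N), ((Perm.sign σ : ℤ) : ℂ) *
      ∏ k, F (σ (.inl k)) (σ (.inr k)) (x k)) =ᵐ[Measure.pi fun _ => intervalMeasure a b]
      fun x => (c : ℂ) * deformedDensity w N f x := by
    filter_upwards [ae_pi_mem_interval a b N] with x hx
    have := congrArg (fun t : ℝ => (t : ℂ)) (hdet x hx)
    simp only [det_apply', Complex.ofReal_mul, Complex.ofReal_sum, Complex.ofReal_prod,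
      Fintype.prod_sum_type, of_apply, Sum.elim_inl, Sum.elim_inr, Complex.ofReal_intCast] at this
    rw [deformedDensity, ← mul_assoc, ← this, Finset.sum_mul]
    refine Finset.sum_congr rfl fun σ _ => ?_
    simp only [F, Finset.prod_mul_distrib, Complex.ofReal_mul]
    ring
  have hsum := integrable_finsetSum Finset.univ fun σ _ => hI σ
  constructor
  · have h := (hsum.congr hae).const_mul ((c : ℂ)⁻¹)
    simpa only [inv_mul_cancel_left₀ hc'] using h
  · rw [← integral_const_mul, ← integral_congr_ae hae, integral_finsetSum _ fun σ _ => hI σ,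
      pfaffianSum]
    refine Finset.sum_congr rfl fun σ _ => ?_
    rw [integral_const_mul, integral_fintype_prod_eq_prod
      (fun k => F (σ (.inl k)) (σ (.inr k)))]
    rfl

/-- The matrix of the skew-symmetric form `∫ (ψ_j ψ_k' - ψ_j' ψ_k) (1 + f)`. -/
def deformedMatrix (a b : EReal) (w : ℝ → ℝ) {n : ℕ} (p : Fin n → ℝ[X]) (f : ℝ → ℂ) :
    Matrix (Fin n) (Fin n) ℂ :=
  Matrix.of fun j k => ∫ x, (momentIntegrand w p j k x : ℂ) * (1 + f x) ∂(intervalMeasure a b)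

/-- Squaring turns the Pfaffian into a determinant. That `c` is chosen before `f` is what lets it
cancel in the ratio defining `momentGen`. -/
theorem exists_integral_deformedDensity_sq_eq (hw_nonneg : ∀ x ∈ interval a b, 0 ≤ w x)
    (hw_diff : DifferentiableOn ℝ (fun x => √(w x)) (interval a b)) (p : Fin (2 * N) → ℝ[X])
    (hp : ∀ j, (p j).degree = ((j : ℕ) : WithBot ℕ))
    (hψ : ∀ j, VanishesAtEnds a b (psi w (p j))) :
    ∃ c : ℂ, ∀ f : ℝ →ᵇ ℂ,
      Integrable (deformedDensity w N f) (Measure.pi fun _ => intervalMeasure a b) ∧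
      (∫ x, deformedDensity w N f x ∂(Measure.pi fun _ => intervalMeasure a b)) ^ 2 =
        c * (deformedMatrix a b w p f).det := by
  obtain ⟨c, hc, hdB⟩ := exists_integral_deformedDensity_eq hw_nonneg hw_diff p hp hψ
  obtain ⟨d, hd⟩ := exists_pfaffianSum_sq_eq ℂ N
  refine ⟨d / (2 ^ N * c) ^ 2, fun f => ⟨(hdB f).1, ?_⟩⟩
  set P : Matrix (Fin N ⊕ Fin N) (Fin N ⊕ Fin N) ℂ := Matrix.of fun r s =>
    ∫ x, ((psi w (p (splitEquiv N r)) x * deriv (psi w (p (splitEquiv N s))) x : ℝ) : ℂ) *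
      (1 + f x) ∂(intervalMeasure a b) with hP
  have hA : (deformedMatrix a b w p f).submatrix (splitEquiv N) (splitEquiv N) = P - Pᵀ := by
    ext r s
    simp only [deformedMatrix, submatrix_apply, of_apply, Matrix.sub_apply, transpose_apply, hP]
    refine Eq.trans ?_ (integral_sub (integrable_mul_deriv_mul (hψ _) (hψ _) (1 + f))
      (integrable_mul_deriv_mul (hψ _) (hψ _) (1 + f)))
    refine integral_congr_ae (ae_of_all _ fun x => ?_)
    simp only [momentIntegrand]
    push_cast
    ring
  have hsq := hd (P - Pᵀ) (by simp) (by simp)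
  rw [pfaffianSum_sub_transpose, ← hA, det_submatrix_equiv_self, ← (hdB f).2, Fintype.card_fin]
    at hsq
  rw [div_mul_eq_mul_div, ← hsq]
  field_simp

end DeBruijn

/-! ### Positivity of the normalization. -/

section Positivity

variable {a b : EReal} {w : ℝ → ℝ}

/-- The density is nonzero on the set of configurations of distinct points of `{w > 0}`, which is
open and nonempty and so has positive measure. -/
theorem partitionFunction_pos (hw_nonneg : ∀ x ∈ interval a b, 0 ≤ w x)
    (hw_pos : ∃ x ∈ interval a b, 0 < w x) (hw_cont : ContinuousOn w (interval a b)) (N : ℕ)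
    (hint : Integrable (density w N) (Measure.pi fun _ => intervalMeasure a b)) :
    0 < partitionFunction a b w N := by
  have hnonneg : 0 ≤ᵐ[Measure.pi fun _ : Fin N => intervalMeasure a b] density w N := by
    filter_upwards [ae_pi_mem_interval a b N] with x hx
    exact mul_nonneg (Finset.prod_nonneg fun j _ => Finset.prod_nonneg fun k _ => by positivity)
      (Finset.prod_nonneg fun j _ => hw_nonneg _ (hx j))
  rw [partitionFunction, integral_pos_iff_support_of_nonneg_ae hnonneg hint]
  let O : Set ℝ := interval a b ∩ w ⁻¹' Set.Ioi 0
  have hO : IsOpen O := hw_cont.isOpen_inter_preimage (isOpen_interval a b) isOpen_Ioi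
  have hOinf : O.Infinite := by
    obtain ⟨x, hx, hwx⟩ := hw_pos
    exact infinite_of_mem_nhds x (hO.mem_nhds ⟨hx, hwx⟩)
  let U : Set (Fin N → ℝ) :=
    {x | (∀ k, x k ∈ O) ∧ ∀ j k, j ≠ k → x j ≠ x k}
  have hU : IsOpen U := by
    refine IsOpen.and ?_ ?_
    · simp only [Set.ofPred_forall]
      exact isOpen_iInter_of_finite fun k => hO.preimage (continuous_apply k)
    · simp only [Set.ofPred_forall]
      exact isOpen_iInter_of_finite fun j => isOpen_iInter_of_finite fun k =>
        isOpen_iInter_of_finite fun _ => isOpen_ne_fun (continuous_apply j) (continuous_apply k)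
  have hUne : U.Nonempty := by
    have g := hOinf.natEmbedding
    refine ⟨fun k => g k, fun k => (g k).2, fun j k hjk h => hjk ?_⟩
    exact Fin.val_injective (g.injective (Subtype.val_injective h))
  have hsupp : U ⊆ Function.support (density w N) := by
    intro x hx
    refine mul_ne_zero ?_ (Finset.prod_ne_zero_iff.2 fun j _ => (hx.1 j).2.ne')
    refine Finset.prod_ne_zero_iff.2 fun j _ => Finset.prod_ne_zero_iff.2 fun k hk => ?_
    exact pow_ne_zero _ (sub_ne_zero.2 (hx.2 j k (Finset.mem_Ioi.1 hk).ne))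
  refine lt_of_lt_of_le ?_ (measure_mono hsupp)
  rw [pi_intervalMeasure, Measure.restrict_apply hU.measurableSet,
    Set.inter_eq_left.2 fun x hx k _ => (hx.1 k).1]
  exact hU.measure_pos _ hUne

end Positivity

/-! ### The scalar kernel as a finite-rank kernel. -/

section Kernel

open Matrix

variable {a b : EReal} {w : ℝ → ℝ}

theorem integrable_deriv_schwartz (f : 𝓢(ℝ, ℂ)) : Integrable (deriv f) (intervalMeasure a b) :=
  ((SchwartzMap.derivCLM ℂ ℂ f).integrable (μ := volume)).restrict

namespace VanishesAtEnds

variable {g h : ℝ → ℝ}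

theorem tendsto_mul_mul {l : Filter ℝ} (hg : Tendsto g l (𝓝 0)) (hh : Tendsto h l (𝓝 0))
    (f : 𝓢(ℝ, ℂ)) : Tendsto (fun x => ((g x * h x : ℝ) : ℂ) * f x) l (𝓝 0) := by
  have h0 : Tendsto (fun x => |g x * h x| * ‖f.toBoundedContinuousFunction‖) l (𝓝 0) := by
    simpa using ((hg.mul hh).abs).mul_const ‖f.toBoundedContinuousFunction‖
  refine squeeze_zero_norm (fun x => ?_) h0
  rw [norm_mul, Complex.norm_real, Real.norm_eq_abs]
  exact mul_le_mul_of_nonneg_left (f.toBoundedContinuousFunction.norm_coe_le_norm x) (abs_nonneg _)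

theorem integrable_mul_mul_deriv (hg : VanishesAtEnds a b g) (hh : VanishesAtEnds a b h)
    (f : 𝓢(ℝ, ℂ)) :
    Integrable (fun x => ((g x * h x : ℝ) : ℂ) * deriv f x) (intervalMeasure a b) := by
  simpa only [Complex.ofReal_mul, mul_assoc] using
    hg.integrable_mul (hh.integrable_mul (integrable_deriv_schwartz f))

theorem integrable_mul_deriv_mul_schwartz (hg : VanishesAtEnds a b g) (hh : VanishesAtEnds a b h)
    (f : 𝓢(ℝ, ℂ)) :
    Integrable (fun x => ((g x * deriv h x : ℝ) : ℂ) * f x) (intervalMeasure a b) :=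
  integrable_mul_deriv_mul hg hh f.toBoundedContinuousFunction

/-- The integrands add up to the derivative of `g h f`, which tends to zero at both ends. -/
theorem integral_by_parts (hg : VanishesAtEnds a b g) (hh : VanishesAtEnds a b h) (f : 𝓢(ℝ, ℂ)) :
    (∫ x, ((g x * deriv h x : ℝ) : ℂ) * f x ∂(intervalMeasure a b)) +
      (∫ x, ((h x * deriv g x : ℝ) : ℂ) * f x ∂(intervalMeasure a b)) +
      ∫ x, ((g x * h x : ℝ) : ℂ) * deriv f x ∂(intervalMeasure a b) = 0 := by
  have h1 := hg.integrable_mul_deriv_mul_schwartz hh f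
  have h2 := hh.integrable_mul_deriv_mul_schwartz hg f
  have h3 := hg.integrable_mul_mul_deriv hh f
  rw [← integral_add h1 h2]
  refine (integral_add (h1.add h2) h3).symm.trans ?_
  refine integral_interval_eq_zero_of_hasDerivAt (g := fun x => ((g x * h x : ℝ) : ℂ) * f x)
    (fun x hx => ?_) ((h1.add h2).add h3) (tendsto_mul_mul hg.left hh.left f)
    (tendsto_mul_mul hg.right hh.right f)
  have hd := (((hg.hasDerivAt x hx).mul (hh.hasDerivAt x hx)).ofReal_comp).mul
    (f.differentiableAt.hasDerivAt (x := x))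
  refine hd.congr_deriv ?_
  push_cast
  simp only [Pi.add_apply, Pi.mul_apply]
  push_cast
  ring

end VanishesAtEnds

theorem integrable_kernel22_mul_epsKernel {n : ℕ} {p : Fin n → ℝ[X]}
    (hψ : ∀ j, VanishesAtEnds a b (psi w (p j))) (x y : ℝ) :
    Integrable (fun t => kernel22 a b w p x t * epsKernel t y) (intervalMeasure a b) := by
  simp only [kernel22, neg_mul, Finset.sum_mul, mul_assoc]
  exact (integrable_finsetSum _ fun j _ => integrable_finsetSum _ fun k _ =>
    (((hψ k).integrable_deriv_mul_epsKernel y).const_mul _).const_mul _).neg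

theorem compKernel_kernel22_epsKernel {n : ℕ} {p : Fin n → ℝ[X]}
    (hψ : ∀ j, VanishesAtEnds a b (psi w (p j))) (x : ℝ) {y : ℝ} (hy : y ∈ interval a b) :
    compKernel a b (kernel22 a b w p) epsKernel x y =
      ∑ j, ∑ k, psi w (p j) x * (momentMatrix a b w p)⁻¹ j k * psi w (p k) y := by
  have hI : ∀ j k, Integrable (fun t => psi w (p j) x * ((momentMatrix a b w p)⁻¹ j k *
      (deriv (psi w (p k)) t * epsKernel t y))) (intervalMeasure a b) := fun j k =>
    (((hψ k).integrable_deriv_mul_epsKernel y).const_mul _).const_mul _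
  simp only [compKernel, kernel22, neg_mul, Finset.sum_mul, mul_assoc]
  rw [integral_neg, integral_finsetSum _ fun j _ => integrable_finsetSum _ fun k _ => hI j k,
    ← Finset.sum_neg_distrib]
  refine Finset.sum_congr rfl fun j _ => ?_
  rw [integral_finsetSum _ fun k _ => hI j k, ← Finset.sum_neg_distrib]
  refine Finset.sum_congr rfl fun k _ => ?_
  rw [integral_const_mul, integral_const_mul, (hψ k).integral_deriv_mul_epsKernel hy]
  ring

/-- The right factors of the finite-rank kernel `2 K f - K ε f'`. -/
def rightFactor (a b : EReal) (w : ℝ → ℝ) {n : ℕ} (p : Fin n → ℝ[X]) (f : ℝ → ℂ) (j : Fin n)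
    (y : ℝ) : ℂ :=
  ∑ k, -(((momentMatrix a b w p)⁻¹ j k : ℝ) : ℂ) *
    (2 * (((deriv (psi w (p k)) y : ℝ) : ℂ) * f y) + (psi w (p k) y : ℂ) * deriv f y)

theorem scalarKernel_eq {n : ℕ} {p : Fin n → ℝ[X]}
    (hψ : ∀ j, VanishesAtEnds a b (psi w (p j))) (f : ℝ → ℂ) (x : ℝ) {y : ℝ}
    (hy : y ∈ interval a b) :
    scalarKernel a b w p f x y = ∑ j, (psi w (p j) x : ℂ) * rightFactor a b w p f j y := by
  rw [scalarKernel, mulKernel, mulKernel, compKernel_kernel22_epsKernel hψ x hy, kernel22]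
  push_cast
  simp only [rightFactor, neg_mul, mul_neg, Finset.mul_sum, Finset.sum_mul]
  rw [← Finset.sum_neg_distrib, ← Finset.sum_sub_distrib]
  refine Finset.sum_congr rfl fun j _ => ?_
  rw [← Finset.sum_neg_distrib, ← Finset.sum_sub_distrib]
  refine Finset.sum_congr rfl fun k _ => ?_
  ring

/-- The matrix `∫ (ψ_j ψ_k' - ψ_j' ψ_k) f`. -/
def perturbationMatrix (a b : EReal) (w : ℝ → ℝ) {n : ℕ} (p : Fin n → ℝ[X]) (f : ℝ → ℂ) :
    Matrix (Fin n) (Fin n) ℂ :=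
  Matrix.of fun j k => ∫ x, (momentIntegrand w p j k x : ℂ) * f x ∂(intervalMeasure a b)

theorem integrable_momentIntegrand {n : ℕ} {p : Fin n → ℝ[X]}
    (hψ : ∀ j, VanishesAtEnds a b (psi w (p j))) (j k : Fin n) :
    Integrable (momentIntegrand w p j k) (intervalMeasure a b) := by
  refine ((hψ j).integrable_mul_deriv (hψ k)).sub (((hψ k).integrable_mul_deriv (hψ j)).congr ?_)
  exact ae_of_all _ fun x => mul_comm _ _

theorem integrable_momentIntegrand_mul {n : ℕ} {p : Fin n → ℝ[X]}
    (hψ : ∀ j, VanishesAtEnds a b (psi w (p j))) (f : 𝓢(ℝ, ℂ)) (j k : Fin n) :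
    Integrable (fun x => (momentIntegrand w p j k x : ℂ) * f x) (intervalMeasure a b) :=
  (integrable_momentIntegrand hψ j k).ofReal.mul_bdd (c := ‖f.toBoundedContinuousFunction‖)
    f.continuous.aestronglyMeasurable
    (ae_of_all _ f.toBoundedContinuousFunction.norm_coe_le_norm)

theorem deformedMatrix_eq_add {n : ℕ} {p : Fin n → ℝ[X]}
    (hψ : ∀ j, VanishesAtEnds a b (psi w (p j))) (f : 𝓢(ℝ, ℂ)) :
    deformedMatrix a b w p f =
      (momentMatrix a b w p).map Complex.ofReal + perturbationMatrix a b w p f := by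
  ext j k
  simp only [deformedMatrix, momentMatrix, perturbationMatrix, of_apply, Matrix.add_apply, map_apply]
  rw [← integral_complex_ofReal]
  refine Eq.trans ?_ (integral_add (integrable_momentIntegrand hψ j k).ofReal
    (integrable_momentIntegrand_mul hψ f j k))
  simp only [mul_add, mul_one]

theorem deformedMatrix_zero {n : ℕ} (p : Fin n → ℝ[X]) :
    deformedMatrix a b w p 0 = (momentMatrix a b w p).map Complex.ofReal := by
  ext j k
  simp only [deformedMatrix, momentMatrix, of_apply, map_apply]
  rw [← integral_complex_ofReal]
  simp

theorem integrable_pairing {n : ℕ} {p : Fin n → ℝ[X]}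
    (hψ : ∀ j, VanishesAtEnds a b (psi w (p j))) (f : 𝓢(ℝ, ℂ)) (k l : Fin n) :
    Integrable (fun x => 2 * (((psi w (p l) x * deriv (psi w (p k)) x : ℝ) : ℂ) * f x) +
      ((psi w (p l) x * psi w (p k) x : ℝ) : ℂ) * deriv f x) (intervalMeasure a b) :=
  (((hψ l).integrable_mul_deriv_mul_schwartz (hψ k) f).const_mul 2).add
    ((hψ l).integrable_mul_mul_deriv (hψ k) f)

/-- Moving the derivative off `f` turns `ψ_l ψ_k f'` into `-(ψ_l ψ_k)' f`, so half of `2 ψ_l ψ_k' f`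
cancels and the antisymmetric combination is left. This explains the shape `2 K f - K ε f'`. -/
theorem integral_pairing {n : ℕ} {p : Fin n → ℝ[X]}
    (hψ : ∀ j, VanishesAtEnds a b (psi w (p j))) (f : 𝓢(ℝ, ℂ)) (k l : Fin n) :
    ∫ x, 2 * (((psi w (p l) x * deriv (psi w (p k)) x : ℝ) : ℂ) * f x) +
      ((psi w (p l) x * psi w (p k) x : ℝ) : ℂ) * deriv f x ∂(intervalMeasure a b) =
      -perturbationMatrix a b w p f k l := by
  have hparts := (hψ l).integral_by_parts (hψ k) f
  have h1 := (hψ l).integrable_mul_deriv_mul_schwartz (hψ k) f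
  have h2 := (hψ k).integrable_mul_deriv_mul_schwartz (hψ l) f
  have hB : perturbationMatrix a b w p f k l =
      (∫ x, ((psi w (p k) x * deriv (psi w (p l)) x : ℝ) : ℂ) * f x ∂(intervalMeasure a b)) -
      ∫ x, ((psi w (p l) x * deriv (psi w (p k)) x : ℝ) : ℂ) * f x ∂(intervalMeasure a b) := by
    rw [← integral_sub h2 h1]
    refine integral_congr_ae (ae_of_all _ fun x => ?_)
    simp only [momentIntegrand]
    push_cast
    ring
  rw [integral_add (h1.const_mul 2) ((hψ l).integrable_mul_mul_deriv (hψ k) f),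
    integral_const_mul, hB]
  linear_combination hparts

theorem rightFactor_mul_psi {n : ℕ} (p : Fin n → ℝ[X]) (f : ℝ → ℂ) (j l : Fin n) (x : ℝ) :
    rightFactor a b w p f j x * (psi w (p l) x : ℂ) =
      ∑ k, -(((momentMatrix a b w p)⁻¹ j k : ℝ) : ℂ) *
        (2 * (((psi w (p l) x * deriv (psi w (p k)) x : ℝ) : ℂ) * f x) +
          ((psi w (p l) x * psi w (p k) x : ℝ) : ℂ) * deriv f x) := by
  rw [rightFactor, Finset.sum_mul]
  refine Finset.sum_congr rfl fun k _ => ?_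
  push_cast
  ring

theorem hasFredholmDet_scalarKernel {n : ℕ} {p : Fin n → ℝ[X]}
    (hψ : ∀ j, VanishesAtEnds a b (psi w (p j))) (f : 𝓢(ℝ, ℂ)) :
    HasFredholmDet a b (scalarKernel a b w p f)
      (1 + (momentMatrix a b w p)⁻¹.map Complex.ofReal * perturbationMatrix a b w p f).det := by
  have hint : ∀ j l, Integrable (fun x => rightFactor a b w p f j x * (psi w (p l) x : ℂ))
      (intervalMeasure a b) := by
    intro j l
    simp only [rightFactor_mul_psi]
    exact integrable_finsetSum _ fun k _ => (integrable_pairing hψ f k l).const_mul _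
  have hG : (Matrix.of fun j l => ∫ x, rightFactor a b w p f j x * (psi w (p l) x : ℂ)
      ∂(intervalMeasure a b)) =
      (momentMatrix a b w p)⁻¹.map Complex.ofReal * perturbationMatrix a b w p f := by
    ext j l
    simp only [of_apply, rightFactor_mul_psi, mul_apply, map_apply]
    rw [integral_finsetSum _ fun k _ => (integrable_pairing hψ f k l).const_mul _]
    refine Finset.sum_congr rfl fun k _ => ?_
    rw [integral_const_mul, integral_pairing hψ f k l, neg_mul_neg]
  obtain ⟨h1, h2⟩ := fredholm_finiteRank (fun l x => (psi w (p l) x : ℂ))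
    (rightFactor a b w p f) hint
  rw [hG] at h2
  -- The factorized form of the kernel needs `y` inside the interval, hence equality only almost
  -- everywhere.
  have hae : ∀ m : ℕ, kernelMinor (scalarKernel a b w p f) m
      =ᵐ[Measure.pi fun _ => intervalMeasure a b] fun x => (Matrix.of fun i j : Fin m =>
        ∑ l, (psi w (p l) (x i) : ℂ) * rightFactor a b w p f l (x j)).det := by
    intro m
    filter_upwards [ae_pi_mem_interval a b m] with x hx
    rw [kernelMinor]
    congr 2
    ext i j
    exact scalarKernel_eq hψ f _ (hx j)
  refine ⟨fun m => (h1 m).congr (hae m).symm, ?_⟩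
  simpa only [integral_congr_ae (hae _)] using h2

end Kernel

end SymplecticEnsemble

end

/-- `w` is a weight on the interval with endpoints `a`, `b` (finite or infinite), with all moments,
with `√w` differentiable inside and with `w(a) = w(b) = 0` (as limits); `π_j`, `j < 2N`, are
arbitrary polynomials of degree `j`, and the `(π_j √w)'` are integrable. The first conjuncts say
that the normalization, `G_N^{(4)}(f)`, the matrix `M^{(4)}`, its inverse and the kernel of `K ε`
are well defined; the last one is the determinant formula. -/
theorem mainTheorem5 (a b : EReal) (w : ℝ → ℝ)
    (hw_nonneg : ∀ x ∈ interval a b, 0 ≤ w x)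
    (hw_pos : ∃ x ∈ interval a b, 0 < w x)
    (hw_moments : ∀ j : ℕ, Integrable (fun x => x ^ j * w x) (intervalMeasure a b))
    (hw_diff : DifferentiableOn ℝ (fun x => √(w x)) (interval a b))
    (hw_left : Tendsto w (comap ((↑) : ℝ → EReal) (𝓝[>] a)) (𝓝 0))
    (hw_right : Tendsto w (comap ((↑) : ℝ → EReal) (𝓝[<] b)) (𝓝 0))
    (N : ℕ) (p : Fin (2 * N) → ℝ[X])
    (hp : ∀ j, (p j).degree = ((j : ℕ) : WithBot ℕ))
    (hp_int : ∀ j, Integrable (deriv (psi w (p j))) (intervalMeasure a b))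
    (f : 𝓢(ℝ, ℂ)) :
    Integrable (density w N) (Measure.pi fun _ => intervalMeasure a b) ∧
    0 < partitionFunction a b w N ∧
    Integrable (deformedDensity w N f) (Measure.pi fun _ => intervalMeasure a b) ∧
    (∀ j k, Integrable (momentIntegrand w p j k) (intervalMeasure a b)) ∧
    IsUnit (momentMatrix a b w p) ∧
    (∀ x ∈ interval a b, ∀ y ∈ interval a b,
      Integrable (fun t => kernel22 a b w p x t * epsKernel t y) (intervalMeasure a b)) ∧
    HasFredholmDet a b (scalarKernel a b w p f) (momentGen a b w N f ^ 2) := by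
  have hψ : ∀ j, VanishesAtEnds a b (psi w (p j)) := fun j =>
    vanishesAtEnds_psi hw_nonneg (hw_pos.imp fun _ h => h.1) hw_moments hw_diff hw_left hw_right
      (p j) (hp_int j)
  have hw_cont : ContinuousOn w (interval a b) :=
    (hw_diff.continuousOn.pow 2).congr fun x hx => (Real.sq_sqrt (hw_nonneg x hx)).symm
  obtain ⟨c, hc⟩ := exists_integral_deformedDensity_sq_eq hw_nonneg hw_diff p hp hψ
  have hdens : deformedDensity w N 0 = fun x => (density w N x : ℂ) := by
    funext x
    simp [deformedDensity]
  -- At `f = 0` the identity reads `Z² = c det M`, with `Z` the partition function; since `Z > 0`,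
  -- neither `c` nor `det M` vanishes.
  have h0 := hc 0
  rw [BoundedContinuousFunction.coe_zero, hdens, deformedMatrix_zero] at h0
  have hint : Integrable (density w N) (Measure.pi fun _ => intervalMeasure a b) := by
    simpa using h0.1.re
  have hpos := partitionFunction_pos hw_nonneg hw_pos hw_cont N hint
  have hZ : (∫ x, (density w N x : ℂ) ∂(Measure.pi fun _ => intervalMeasure a b)) =
      (partitionFunction a b w N : ℂ) := integral_complex_ofReal
  have hZne : (partitionFunction a b w N : ℂ) ≠ 0 := by exact_mod_cast hpos.ne'
  have h0sq := h0.2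
  rw [hZ] at h0sq
  have hprod : c * ((momentMatrix a b w p).map Complex.ofReal).det ≠ 0 := by
    rw [← h0sq]
    exact pow_ne_zero 2 hZne
  have hdetC : ((momentMatrix a b w p).map Complex.ofReal).det =
      ((momentMatrix a b w p).det : ℂ) := (Complex.ofRealHom.map_det _).symm
  have hdet : IsUnit (momentMatrix a b w p).det := by
    have := right_ne_zero_of_mul hprod
    rw [hdetC] at this
    exact isUnit_iff_ne_zero.2 (by exact_mod_cast this)
  have hf := hc f.toBoundedContinuousFunction
  refine ⟨hint, hpos, hf.1, integrable_momentIntegrand hψ,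
    (Matrix.isUnit_iff_isUnit_det _).2 hdet,
    fun x _ y _ => integrable_kernel22_mul_epsKernel hψ x y, ?_⟩
  convert hasFredholmDet_scalarKernel hψ f using 1
  have hinv : (momentMatrix a b w p).map Complex.ofReal *
      (momentMatrix a b w p)⁻¹.map Complex.ofReal = 1 := by
    have := congrArg (Complex.ofRealHom.mapMatrix) (Matrix.mul_nonsing_inv _ hdet)
    rwa [map_mul, map_one] at this
  -- `M (1 + M⁻¹ P) = M + P`, so the quotient of the squared integrals is `det (1 + M⁻¹ P)`.
  have hmul : ((momentMatrix a b w p).map Complex.ofReal).det *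
      (1 + (momentMatrix a b w p)⁻¹.map Complex.ofReal * perturbationMatrix a b w p f).det =
      (deformedMatrix a b w p f).det := by
    rw [← Matrix.det_mul, mul_add, mul_one, ← mul_assoc, hinv, one_mul, deformedMatrix_eq_add hψ]
  have hfsq : (∫ x, deformedDensity w N f x ∂(Measure.pi fun _ => intervalMeasure a b)) ^ 2 =
      c * (deformedMatrix a b w p f).det := hf.2
  rw [momentGen, div_pow, hfsq, h0sq, ← hmul, ← mul_assoc, mul_div_cancel_left₀ _ hprod]
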